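/- Let $\mathbb X,\mathbb Y,\mathbb P$ be finite-dimensional Euclidean spaces, $K:\mathbb X\to\mathbb Y$ linear with adjoint $K^*$, $f:\mathbb X\times\mathbb P\to\mathbb R$ twice continuously differentiable with $f(\cdot,p)$ convex for every $p\in\mathbb P$, and $g:\mathbb Y\to\mathbb R\cup\{\infty\}$ proper, lower semicontinuous and convex with Fenchel conjugate $g^*$. Write $\partial$ for the convex subdifferential and $$T_\Omega(z)=\{w:\ \exists\, t_k\downarrow 0,\ w_k\to w \text{ with } z+t_kw_k\in\Omega\}$$ for the tangent cone. For $(p,v)\in\mathbb P\times\mathbb Y$ let $\widetilde S(p,v)$ be the set of all $(x,y)\in\mathbb X\times\mathbb Y$ with $$0=\nabla_xf(x,p)+K^*y,\qquad v\in -Kx+\partial g^*(y),$$ the primal-dual system of $\min_x f(x,p)+g(Kx+v)$. Fix $\bar p\in\mathbb P$ and $(\bar x,\bar y)\in\widetilde S(\bar p,0)$. For $(u,v)\in\mathbb X\times\mathbb Y$ let $\widehat S(u,v)$ be the set of all $(x,y)\in\mathbb X\times\mathbb Y$ with $$u=\nabla_xf(\bar x,\bar p)+\nabla^2_{xx}f(\bar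 x,\bar p)(x-\bar x)+K^*y,\qquad v\in -Kx+\partial g^*(y).$$ A set-valued map $S$ is isolated calm at $\bar q$ for $\bar z\in S(\bar q)$ if there are $\ell>0$ and neighborhoods $U$ of $\bar z$ and $V$ of $\bar q$ with $\|z-\bar z\|\le\ell\|q-\bar q\|$ whenever $q\in V$ and $z\in S(q)\cap U$. A function $\varphi$ satisfies the quadratic growth condition at $\bar z$ for $\bar w\in\partial\varphi(\bar z)$ if there are $c,\varepsilon>0$ with $\varphi(z)\ge\varphi(\bar z)+\langle\bar w,z-\bar z\rangle+\frac c2\,d(z;(\partial\varphi)^{-1}(\bar w))^2$ whenever $\|z-\bar z\|<\varepsilon$; $g$ satisfies the primal-dual quadratic growth condition at $K\bar x$ for $\bar y$ if $g$ satisfies this condition at $K\bar x$ for $\bar y$ and $g^*$ satisfies it at $\bar y$ for $K\bar x$. 1. If $\widehat S$ is isolated calm at $(0,0)$ for $(\bar x,\bar y)$, then $$\operatorname{Ker}K^*\cap T_{\partial g(K\bar x)}(\bar y)=\{0\}\quad\text{and}\quad \operatorname{Ker}\nabla^2_{xx}f(\bar x,\bar p)\cap K^{-1}\bigl(T_{\partial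 g^*(\bar y)}(K\bar x)\bigr)=\{0\}.$$ 2. If $g$ satisfies the primal-dual quadratic growth condition at $K\bar x$ for $\bar y$ and these two conditions hold, then $\widehat S$ is isolated calm at $(0,0)$ for $(\bar x,\bar y)$, and $\widetilde S$ is isolated calm at $(\bar p,0)$ for $(\bar x,\bar y)$. -/

import Mathlib

open Set Filter Topology

noncomputable section

namespace PrimalDual

section Basic

variable {E : Type*} [NormedAddCommGroup E] [InnerProductSpace ℝ E]

/-- The Bouligand/Severi (contingent) tangent cone to `Ω` at `x`: all `w` for which there are
`t k ↓ 0` and `w k → w` with `x + t k • w k ∈ Ω`. -/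
def tangentCone (Ω : Set E) (x : E) : Set E :=
  {w | ∃ (t : ℕ → ℝ) (u : ℕ → E), (∀ k, 0 < t k) ∧ Tendsto t atTop (𝓝 0) ∧
    Tendsto u atTop (𝓝 w) ∧ ∀ k, x + t k • u k ∈ Ω}

/-- `φ : E → ℝ ∪ {∞}` is proper, lower semicontinuous and convex.  The value `-∞` is excluded,
and convexity is convexity of the epigraph. -/
structure ProperLscConvex (φ : E → EReal) : Prop where
  ne_bot : ∀ x, φ x ≠ ⊥
  exists_ne_top : ∃ x, φ x ≠ ⊤
  lsc : LowerSemicontinuous φ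
  convex_epigraph : Convex ℝ {z : E × ℝ | φ z.1 ≤ (z.2 : EReal)}

/-- The convex subdifferential `∂φ(x)`; it is empty outside the domain of `φ`. -/
def subdiff (φ : E → EReal) (x : E) : Set E :=
  {v | φ x ≠ ⊤ ∧ ∀ u, φ x + ((inner ℝ v (u - x) : ℝ) : EReal) ≤ φ u}

/-- The Fenchel conjugate `φ*(v) = sup_x (⟨v, x⟩ - φ(x))`. -/
def conj (φ : E → EReal) (v : E) : EReal :=
  ⨆ x, ((inner ℝ v x : ℝ) : EReal) - φ x

/-- The quadratic growth condition of `φ` at `x₀` for `v₀ ∈ ∂φ(x₀)`: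
`φ(x) ≥ φ(x₀) + ⟨v₀, x - x₀⟩ + (c/2) d(x; (∂φ)⁻¹(v₀))²` for all `x` in a ball around `x₀`. -/
def QuadraticGrowth (φ : E → EReal) (x₀ v₀ : E) : Prop :=
  v₀ ∈ subdiff φ x₀ ∧
  ∃ c > (0 : ℝ), ∃ ε > (0 : ℝ), ∀ x ∈ Metric.ball x₀ ε,
    φ x₀ + ((inner ℝ v₀ (x - x₀) +
      c / 2 * (Metric.infDist x {u | v₀ ∈ subdiff φ u}) ^ 2 : ℝ) : EReal) ≤ φ x

/-- The primal-dual quadratic growth condition of `φ` at `x₀` for `v₀ ∈ ∂φ(x₀)`. -/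
def PrimalDualQuadraticGrowth (φ : E → EReal) (x₀ v₀ : E) : Prop :=
  QuadraticGrowth φ x₀ v₀ ∧ QuadraticGrowth (conj φ) v₀ x₀

end Basic

/-- Isolated calmness of a set-valued mapping `S` at `q₀` for `z₀ ∈ S q₀`.  For product spaces
the choice among the equivalent product norms only changes the constant `ℓ`. -/
def IsolatedCalm {Q Z : Type*} [PseudoMetricSpace Q] [PseudoMetricSpace Z]
    (S : Q → Set Z) (q₀ : Q) (z₀ : Z) : Prop :=
  z₀ ∈ S q₀ ∧ ∃ ℓ > (0 : ℝ), ∃ U ∈ 𝓝 z₀, ∃ V ∈ 𝓝 q₀,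
    ∀ q ∈ V, ∀ z ∈ S q ∩ U, dist z z₀ ≤ ℓ * dist q q₀

section System

variable {X Y P : Type*}
  [NormedAddCommGroup X] [InnerProductSpace ℝ X] [FiniteDimensional ℝ X]
  [NormedAddCommGroup Y] [InnerProductSpace ℝ Y] [FiniteDimensional ℝ Y]

/-- The partial gradient `∇ₓ f(x, p)`. -/
def gradX (f : X × P → ℝ) (x : X) (p : P) : X :=
  gradient (fun x' => f (x', p)) x

/-- The partial Hessian `∇²ₓₓ f(x, p)` as a linear operator on `X`. -/
def hessX (f : X × P → ℝ) (x : X) (p : P) : X →L[ℝ] X :=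
  fderiv ℝ (fun x' => gradX f x' p) x

/-- The solution mapping `S̃(p, v)` of the primal-dual system
`0 = ∇ₓ f(x, p) + K* y`, `v ∈ -K x + ∂g*(y)`. -/
def primalDualSol (f : X × P → ℝ) (g : Y → EReal) (K : X →ₗ[ℝ] Y) :
    P × Y → Set (X × Y) :=
  fun q => {z | 0 = gradX f z.1 q.1 + LinearMap.adjoint K z.2 ∧
    ∃ w ∈ subdiff (conj g) z.2, q.2 = -K z.1 + w}

/-- The solution mapping `Ŝ(u, v)` of the primal-dual system linearized at `(x₀, p₀)`:
`u = ∇ₓ f(x₀, p₀) + ∇²ₓₓ f(x₀, p₀) (x - x₀) + K* y`, `v ∈ -K x + ∂g*(y)`. -/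
def linPrimalDualSol (f : X × P → ℝ) (g : Y → EReal) (K : X →ₗ[ℝ] Y) (x₀ : X) (p₀ : P) :
    X × Y → Set (X × Y) :=
  fun q => {z | q.1 = gradX f x₀ p₀ + hessX f x₀ p₀ (z.1 - x₀) + LinearMap.adjoint K z.2 ∧
    ∃ w ∈ subdiff (conj g) z.2, q.2 = -K z.1 + w}

/-- The strict Robinson constraint qualification `Ker K* ∩ T_{∂g(K x₀)}(y₀) = {0}`. -/
def SRCQ (g : Y → EReal) (K : X →ₗ[ℝ] Y) (x₀ : X) (y₀ : Y) : Prop :=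
  {y | LinearMap.adjoint K y = 0} ∩ tangentCone (subdiff g (K x₀)) y₀ = {0}

/-- The condition `Ker ∇²ₓₓ f(x₀, p₀) ∩ K⁻¹ (T_{∂g*(y₀)}(K x₀)) = {0}`. -/
def HessianKernelCondition (f : X × P → ℝ) (g : Y → EReal) (K : X →ₗ[ℝ] Y)
    (x₀ : X) (p₀ : P) (y₀ : Y) : Prop :=
  {x | hessX f x₀ p₀ x = 0} ∩ K ⁻¹' tangentCone (subdiff (conj g) y₀) (K x₀) = {0}

end System

end PrimalDual

end

/-!
Both parts rest on the description of isolated calmness by limits of difference quotients: `S` is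
isolated calm at `q₀` for `z₀` exactly when `δ = 0` for every limit `δ` of directions `d k` with
`z₀ + t k • d k ∈ S (q₀ + t k • e k)`, `t k ↓ 0` and `e k → 0`
(`isolatedCalm_of_forall_direction_eq_zero`, by compactness of the unit sphere, and
`IsolatedCalm.direction_eq_zero`).

For necessity, a tangent vector `η ∈ Ker K*` to `∂g(K x₀)` yields the direction `(0, η)` of the
linearized solution map, and a vector `ξ` of the Hessian kernel with `K ξ` tangent to `∂g*(y₀)`
yields `(ξ, 0)`; so both vanish.

For sufficiency, a limit direction `(ξ, η)` of the linearized system satisfies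
`∇²ₓₓ f ξ + K* η = 0`, whence `⟨η, K ξ⟩ = -⟨∇²ₓₓ f ξ, ξ⟩ ≤ 0` because the Hessian is positive
(`hessX_isPositive`). On the other hand, quadratic growth bounds the monotonicity product of a
subgradient below by a squared distance (`QuadraticGrowth.exists_mul_infDist_sq_le_inner`). Applied
to `g` and to `g*`, this gives `⟨η, K ξ⟩ ≥ 0`, and in the case of equality the tangency of `K ξ` to
`∂g*(y₀)` and of `η` to `∂g(K x₀)`. Hence `∇²ₓₓ f ξ = 0` and `K* η = 0`, and the two kernel
conditions give `(ξ, η) = 0`. The nonlinear system is a perturbation of the linearized one by a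
first-order Taylor remainder of `∇ₓ f`, small enough to be absorbed (`isolatedCalm_primalDualSol`).

The passage between `∂g` and `∂g*` is the inversion `∂g* = (∂g)⁻¹`, whose nontrivial half is
`mem_subdiff_of_mem_subdiff_conj`, proved by separating a point from the epigraph of `g`.
-/

open Set Filter Topology

noncomputable section

namespace PrimalDual

/-! ### Subgradients, conjugates and the Fenchel–Moreau inversion -/

section Conjugate

variable {E : Type*} [NormedAddCommGroup E] [InnerProductSpace ℝ E]

theorem conj_ne_bot {φ : E → EReal} (hφ : ∃ x, φ x ≠ ⊤) (v : E) : conj φ v ≠ ⊥ := by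
  obtain ⟨x, hx⟩ := hφ
  have h : ((inner ℝ v x : ℝ) : EReal) - φ x ≤ conj φ v :=
    le_iSup (fun x => ((inner ℝ v x : ℝ) : EReal) - φ x) x
  intro hbot
  rw [hbot, le_bot_iff] at h
  induction hr : φ x with
  | bot => simp [hr] at h
  | top => exact hx hr
  | coe r => rw [hr, ← EReal.coe_sub] at h; exact EReal.coe_ne_bot _ h

theorem conj_le_coe_iff {φ : E → EReal} (hφ : ∀ x, φ x ≠ ⊥) (v : E) (s : ℝ) :
    conj φ v ≤ s ↔ ∀ (x : E) (r : ℝ), φ x ≤ r → inner ℝ v x - r ≤ s := by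
  rw [conj, iSup_le_iff]
  refine forall_congr' fun x => ?_
  induction hr : φ x with
  | bot => exact absurd hr (hφ x)
  | top => simp
  | coe a =>
    rw [← EReal.coe_sub, EReal.coe_le_coe_iff]
    constructor
    · intro h r har
      have := EReal.coe_le_coe_iff.1 har
      linarith
    · intro h
      exact h a le_rfl

/-- For a function without the value `-∞`, a subgradient inequality is one between real numbers. -/
theorem mem_subdiff_iff {φ : E → EReal} (hφ : ∀ x, φ x ≠ ⊥) {x v : E} :
    v ∈ subdiff φ x ↔
      ∃ a : ℝ, φ x = a ∧ ∀ (u : E) (r : ℝ), φ u ≤ r → a + inner ℝ v (u - x) ≤ r := by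
  constructor
  · rintro ⟨hx, h⟩
    refine ⟨(φ x).toReal, (EReal.coe_toReal hx (hφ x)).symm, fun u r hu => ?_⟩
    have := (h u).trans hu
    rw [← EReal.coe_toReal hx (hφ x)] at this
    exact_mod_cast this
  · rintro ⟨a, ha, h⟩
    refine ⟨by rw [ha]; exact EReal.coe_ne_top a, fun u => ?_⟩
    rw [ha]
    induction hr : φ u with
    | bot => exact absurd hr (hφ u)
    | top => exact le_top
    | coe r => exact_mod_cast h u r hr.le

theorem mem_subdiff_conj_of_mem_subdiff {φ : E → EReal} (hφ : ∀ x, φ x ≠ ⊥) {x v : E}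
    (h : v ∈ subdiff φ x) : x ∈ subdiff (conj φ) v := by
  obtain ⟨a, ha, hsub⟩ := (mem_subdiff_iff hφ).1 h
  have hdom : ∃ x, φ x ≠ ⊤ := ⟨x, h.1⟩
  have hle (u : E) (r : ℝ) (hr : conj φ u ≤ r) : inner ℝ u x - a ≤ r :=
    (conj_le_coe_iff hφ u r).1 hr x a ha.le
  have hval : conj φ v ≤ ((inner ℝ v x - a : ℝ) : EReal) := by
    refine (conj_le_coe_iff hφ _ _).2 fun u r hr => ?_
    have := hsub u r hr
    rw [inner_sub_right] at this
    linarith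
  refine (mem_subdiff_iff (conj_ne_bot hdom)).2 ⟨inner ℝ v x - a, ?_, fun u r hr => ?_⟩
  · refine le_antisymm hval ?_
    induction hc : conj φ v with
    | bot => exact absurd hc (conj_ne_bot hdom v)
    | top => exact le_top
    | coe b => exact EReal.coe_le_coe_iff.2 (hle v b hc.le)
  · have := hle u r hr
    rw [inner_sub_right, real_inner_comm u x, real_inner_comm v x]
    linarith

theorem ProperLscConvex.isClosed_epigraph {φ : E → EReal} (hφ : ProperLscConvex φ) :
    IsClosed {z : E × ℝ | φ z.1 ≤ (z.2 : EReal)} :=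
  hφ.lsc.isClosed_epigraph.preimage
    (continuous_fst.prodMk (continuous_coe_real_ereal.comp continuous_snd))

/-- The inversion `∂φ* = (∂φ)⁻¹`, in the direction that needs `φ` to be closed and convex: if
`φ(x)` were larger than `⟨x, v⟩ - φ*(v)`, a hyperplane separating this point from the epigraph
would violate the subgradient inequality of `φ*` at `v`. -/
theorem mem_subdiff_of_mem_subdiff_conj [CompleteSpace E] {φ : E → EReal}
    (hφ : ProperLscConvex φ) {x v : E} (h : x ∈ subdiff (conj φ) v) : v ∈ subdiff φ x := by
  obtain ⟨β, hβ, hsub⟩ := (mem_subdiff_iff (conj_ne_bot hφ.exists_ne_top)).1 h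
  have hFY := (conj_le_coe_iff hφ.ne_bot v β).1 hβ.le
  suffices hx : φ x ≤ ((inner ℝ v x - β : ℝ) : EReal) by
    refine (mem_subdiff_iff hφ.ne_bot).2 ⟨inner ℝ v x - β, le_antisymm hx ?_, fun u r hr => ?_⟩
    · induction hr : φ x with
      | bot => exact absurd hr (hφ.ne_bot x)
      | top => exact le_top
      | coe r =>
        have := hFY x r hr.le
        exact EReal.coe_le_coe_iff.2 (by linarith)
    · have := hFY u r hr
      rw [inner_sub_right]
      linarith
  by_contra hx
  obtain ⟨ℓ, s, hlt, hgt⟩ := geometric_hahn_banach_point_closed hφ.convex_epigraph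
    hφ.isClosed_epigraph (x := (x, inner ℝ v x - β)) hx
  set a : E := (InnerProductSpace.toDual ℝ E).symm
    (ℓ.comp (ContinuousLinearMap.inl ℝ E ℝ)) with ha
  set b : ℝ := ℓ (0, 1) with hb
  have hℓ (u : E) (r : ℝ) : ℓ (u, r) = inner ℝ a u + r * b := by
    have h1 : ((u, r) : E × ℝ) = (u, 0) + r • ((0, 1) : E × ℝ) := by simp
    rw [h1, map_add, map_smul, smul_eq_mul, ha, InnerProductSpace.toDual_symm_apply]
    rfl
  rw [hℓ] at hlt
  have hepi (u : E) (r : ℝ) (hr : φ u ≤ r) : s < inner ℝ a u + r * b := by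
    rw [← hℓ]
    exact hgt (u, r) hr
  obtain ⟨x₁, hx₁⟩ := hφ.exists_ne_top
  obtain ⟨r₁, hr₁⟩ : ∃ r : ℝ, φ x₁ ≤ r :=
    ⟨_, EReal.le_coe_toReal hx₁⟩
  -- the epigraph is unbounded upwards
  have hb0 : 0 ≤ b := by
    by_contra! hneg
    have hpos : 0 < -b := neg_pos.2 hneg
    set m : ℝ := |inner ℝ a x₁ + r₁ * b - s| / (-b) with hm
    have hm0 : 0 ≤ m := by positivity
    have h2 := hepi x₁ (r₁ + m) (hr₁.trans (by exact_mod_cast (by linarith : r₁ ≤ r₁ + m)))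
    have h3 : m * (-b) = |inner ℝ a x₁ + r₁ * b - s| := div_mul_cancel₀ _ hpos.ne'
    have h4 := le_abs_self (inner ℝ a x₁ + r₁ * b - s)
    linarith
  rcases hb0.eq_or_lt with hb0 | hb0
  · -- a vertical hyperplane: test the subgradient inequality of `φ*` at `v - a`
    have h1 : conj φ (v - a) ≤ ((β - s : ℝ) : EReal) := by
      refine (conj_le_coe_iff hφ.ne_bot _ _).2 fun u r hr => ?_
      have h2 := hFY u r hr
      have h3 := hepi u r hr
      rw [← hb0] at h3
      rw [inner_sub_left]
      linarith
    have h2 := hsub _ _ h1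
    rw [sub_sub_cancel_left, inner_neg_right, real_inner_comm] at h2
    rw [← hb0] at hlt
    linarith
  · -- otherwise the hyperplane is the graph of an affine minorant with slope `-b⁻¹ • a`
    have h1 : conj φ (-(b⁻¹ • a)) ≤ ((-(b⁻¹ * s) : ℝ) : EReal) := by
      refine (conj_le_coe_iff hφ.ne_bot _ _).2 fun u r hr => ?_
      have h3 := mul_le_mul_of_nonneg_left (hepi u r hr).le (inv_nonneg.2 hb0.le)
      have h4 : b⁻¹ * (inner ℝ a u + r * b) = b⁻¹ * inner ℝ a u + r := by
        field_simp
      rw [inner_neg_left, real_inner_smul_left]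
      linarith
    have h2 := hsub _ _ h1
    have h3 := mul_lt_mul_of_pos_left hlt (inv_pos.2 hb0)
    have h4 : b⁻¹ * (inner ℝ a x + (inner ℝ v x - β) * b)
        = b⁻¹ * inner ℝ a x + (inner ℝ v x - β) := by
      field_simp
    rw [inner_sub_right, inner_neg_right, real_inner_smul_right, real_inner_comm a x,
      real_inner_comm v x] at h2
    linarith

/-- Adding the growth inequality at `x` to the subgradient inequality of `v` at `x` bounds the
monotonicity product of `∂φ` below by a multiple of the squared distance to `(∂φ)⁻¹(v₀)`. -/
theorem QuadraticGrowth.exists_mul_infDist_sq_le_inner {φ : E → EReal} (hφ : ∀ x, φ x ≠ ⊥)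
    {x₀ v₀ : E} (h : QuadraticGrowth φ x₀ v₀) :
    ∃ c > (0 : ℝ), ∃ ε > (0 : ℝ), ∀ x ∈ Metric.ball x₀ ε, ∀ v ∈ subdiff φ x,
      c * Metric.infDist x {u | v₀ ∈ subdiff φ u} ^ 2 ≤ inner ℝ (v - v₀) (x - x₀) := by
  obtain ⟨hv₀, c, hc, ε, hε, hgrow⟩ := h
  refine ⟨c / 2, by positivity, ε, hε, fun x hx v hv => ?_⟩
  obtain ⟨a₀, ha₀, -⟩ := (mem_subdiff_iff hφ).1 hv₀
  obtain ⟨a, ha, hsub⟩ := (mem_subdiff_iff hφ).1 hv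
  have h1 := hgrow x hx
  rw [ha₀, ha] at h1
  have h1' : a₀ + (inner ℝ v₀ (x - x₀) +
      c / 2 * (Metric.infDist x {u | v₀ ∈ subdiff φ u}) ^ 2) ≤ a := by exact_mod_cast h1
  have h2 := hsub x₀ a₀ ha₀.le
  rw [← neg_sub x x₀, inner_neg_right] at h2
  rw [inner_sub_left]
  linarith

end Conjugate

/-! ### Sequences: tangent cones and isolated calmness -/

section Sequences

theorem zero_mem_tangentCone {E : Type*} [NormedAddCommGroup E] [InnerProductSpace ℝ E]
    {Ω : Set E} {x : E} (hx : x ∈ Ω) : (0 : E) ∈ tangentCone Ω x :=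
  ⟨fun k => 1 / ((k : ℝ) + 1), fun _ => 0, fun k => by positivity,
    tendsto_one_div_add_atTop_nhds_zero_nat, tendsto_const_nhds, fun k => by simpa using hx⟩

/-- The limit direction of a sequence whose distance to `Ω` is `o(t k)` is tangent to `Ω`. -/
theorem mem_tangentCone_of_tendsto_infDist {E : Type*} [NormedAddCommGroup E]
    [InnerProductSpace ℝ E] {Ω : Set E} (hΩ : Ω.Nonempty) {x w : E} {t : ℕ → ℝ} {u : ℕ → E}
    (ht : ∀ k, 0 < t k) (ht0 : Tendsto t atTop (𝓝 0)) (hu : Tendsto u atTop (𝓝 w))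
    (hd : Tendsto (fun k => Metric.infDist (x + t k • u k) Ω / t k) atTop (𝓝 0)) :
    w ∈ tangentCone Ω x := by
  have hex (k : ℕ) : ∃ a ∈ Ω, dist (x + t k • u k) a <
      Metric.infDist (x + t k • u k) Ω + t k * (1 / ((k : ℝ) + 1)) :=
    (Metric.infDist_lt_iff hΩ).1 (lt_add_of_pos_right _ (mul_pos (ht k) (by positivity)))
  choose a ha hlt using hex
  refine ⟨t, fun k => (t k)⁻¹ • (a k - x), ht, ht0, ?_, fun k => ?_⟩
  · refine tendsto_of_tendsto_of_dist hu ?_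
    have hsum := hd.add tendsto_one_div_add_atTop_nhds_zero_nat
    rw [add_zero] at hsum
    refine squeeze_zero (fun _ => dist_nonneg) (fun k => ?_) hsum
    have h1 : u k - (t k)⁻¹ • (a k - x) = (t k)⁻¹ • (x + t k • u k - a k) := by
      have : u k = (t k)⁻¹ • (t k • u k) := by rw [inv_smul_smul₀ (ht k).ne']
      nth_rw 1 [this]
      module
    rw [dist_eq_norm, h1, norm_smul, ← dist_eq_norm, Real.norm_of_nonneg (inv_nonneg.2 (ht k).le),
      inv_mul_le_iff₀ (ht k)]
    refine (hlt k).le.trans_eq ?_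
    have := (ht k).ne'
    field_simp
  · rw [smul_inv_smul₀ (ht k).ne', add_sub_cancel]
    exact ha k

/-- The graphical-derivative criterion: `S` is isolated calm at `q₀` for `z₀` as soon as `0` is the
only limit of difference quotients of `S` along parameters with `q k - q₀ = o(t k)`. -/
theorem isolatedCalm_of_forall_direction_eq_zero {Q Z : Type*} [NormedAddCommGroup Q]
    [NormedSpace ℝ Q] [NormedAddCommGroup Z] [NormedSpace ℝ Z] [FiniteDimensional ℝ Z]
    {S : Q → Set Z} {q₀ : Q} {z₀ : Z} (hz₀ : z₀ ∈ S q₀)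
    (h : ∀ (t : ℕ → ℝ) (e : ℕ → Q) (d : ℕ → Z) (δ : Z), (∀ k, 0 < t k) →
      Tendsto t atTop (𝓝 0) → Tendsto e atTop (𝓝 0) → Tendsto d atTop (𝓝 δ) →
      (∀ k, z₀ + t k • d k ∈ S (q₀ + t k • e k)) → δ = 0) :
    IsolatedCalm S q₀ z₀ := by
  have := FiniteDimensional.proper ℝ Z
  refine ⟨hz₀, ?_⟩
  by_contra! hneg
  have hex (n : ℕ) : ∃ q : Q, ∃ z : Z, z ∈ S q ∧ dist z z₀ < 1 / ((n : ℝ) + 1) ∧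
      ((n : ℝ) + 1) * dist q q₀ < dist z z₀ := by
    have hpos : (0 : ℝ) < 1 / ((n : ℝ) + 1) := by positivity
    obtain ⟨q, -, z, hz, hlt⟩ := hneg ((n : ℝ) + 1) (by positivity) _ (Metric.ball_mem_nhds z₀ hpos)
      univ univ_mem
    exact ⟨q, z, hz.1, hz.2, hlt⟩
  choose q z hzS hzlt hqlt using hex
  let t : ℕ → ℝ := fun n => dist (z n) z₀
  have htpos (n : ℕ) : 0 < t n := lt_of_le_of_lt (by positivity) (hqlt n)
  have ht0 : Tendsto t atTop (𝓝 0) :=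
    squeeze_zero (fun n => (htpos n).le) (fun n => (hzlt n).le)
      tendsto_one_div_add_atTop_nhds_zero_nat
  have hd (n : ℕ) : (t n)⁻¹ • (z n - z₀) ∈ Metric.sphere (0 : Z) 1 := by
    rw [mem_sphere_zero_iff_norm, norm_smul, Real.norm_of_nonneg (inv_nonneg.2 (htpos n).le),
      ← dist_eq_norm]
    exact inv_mul_cancel₀ (htpos n).ne'
  have he : Tendsto (fun n => (t n)⁻¹ • (q n - q₀)) atTop (𝓝 0) := by
    refine squeeze_zero_norm (fun n => ?_) tendsto_one_div_add_atTop_nhds_zero_nat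
    rw [norm_smul, Real.norm_of_nonneg (inv_nonneg.2 (htpos n).le), inv_mul_le_iff₀ (htpos n),
      ← dist_eq_norm, mul_one_div, le_div_iff₀ (by positivity), mul_comm]
    exact (hqlt n).le
  obtain ⟨δ, hδ, ψ, hψ, hlim⟩ := (isCompact_sphere (0 : Z) 1).tendsto_subseq hd
  have hzero := h (t ∘ ψ) _ _ δ (fun k => htpos _) (ht0.comp hψ.tendsto_atTop)
    (he.comp hψ.tendsto_atTop) hlim fun k => by
      simp only [Function.comp_apply, smul_inv_smul₀ (htpos _).ne', add_sub_cancel]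
      exact hzS _
  rw [hzero] at hδ
  simp at hδ

theorem IsolatedCalm.direction_eq_zero {Q Z : Type*} [NormedAddCommGroup Q] [NormedSpace ℝ Q]
    [NormedAddCommGroup Z] [NormedSpace ℝ Z] {S : Q → Set Z} {q₀ : Q} {z₀ : Z}
    (h : IsolatedCalm S q₀ z₀) {t : ℕ → ℝ} {e : ℕ → Q} {d : ℕ → Z} {δ : Z} (ht : ∀ k, 0 < t k)
    (ht0 : Tendsto t atTop (𝓝 0)) (he : Tendsto e atTop (𝓝 0)) (hd : Tendsto d atTop (𝓝 δ))
    (hmem : ∀ k, z₀ + t k • d k ∈ S (q₀ + t k • e k)) : δ = 0 := by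
  obtain ⟨-, ℓ, hℓ, U, hU, V, hV, hcalm⟩ := h
  have hz : Tendsto (fun k => z₀ + t k • d k) atTop (𝓝 z₀) := by
    simpa using (ht0.smul hd).const_add z₀
  have hq : Tendsto (fun k => q₀ + t k • e k) atTop (𝓝 q₀) := by
    simpa using (ht0.smul he).const_add q₀
  have hle : ∀ᶠ k in atTop, ‖d k‖ ≤ ℓ * ‖e k‖ := by
    filter_upwards [hz.eventually hU, hq.eventually hV] with k hkU hkV
    have h1 := hcalm _ hkV _ ⟨hmem k, hkU⟩
    rw [dist_self_add_left, dist_self_add_left, norm_smul, norm_smul,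
      Real.norm_of_nonneg (ht k).le, mul_left_comm] at h1
    exact le_of_mul_le_mul_left h1 (ht k)
  have hlim := le_of_tendsto_of_tendsto hd.norm (he.norm.const_mul ℓ) hle
  rwa [norm_zero, mul_zero, norm_le_zero_iff] at hlim

end Sequences

/-! ### The Hessian of a convex function -/

section Hessian

variable {X P : Type*} [NormedAddCommGroup X] [InnerProductSpace ℝ X] [FiniteDimensional ℝ X]

theorem inner_gradX {f : X × P → ℝ} (x v : X) (p : P) :
    inner ℝ (gradX f x p) v = fderiv ℝ (fun x' => f (x', p)) x v := by
  rw [gradX, gradient, InnerProductSpace.toDual_symm_apply]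

variable [NormedAddCommGroup P] [InnerProductSpace ℝ P]

theorem eq_zero_of_isPositive_of_inner_eq_zero {E : Type*}
    [NormedAddCommGroup E] [InnerProductSpace ℝ E] {T : E →L[ℝ] E}
    (hT : T.IsPositive) {x : E} (hx : inner ℝ (T x) x = 0) : T x = 0 := by
  by_contra hne
  have ha : 0 < inner ℝ (T x) (T x) := real_inner_self_pos.2 hne
  have hb : 0 ≤ inner ℝ (T (T x)) (T x) := hT.inner_nonneg_left _
  have hq (s : ℝ) : 0 ≤ s * (s * inner ℝ (T (T x)) (T x) - 2 * inner ℝ (T x) (T x)) := by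
    have h1 := hT.inner_nonneg_left (x - s • T x)
    have h2 : inner ℝ (T (T x)) x = inner ℝ (T x) (T x) := hT.inner_left_eq_inner_right _ _
    simp only [map_sub, map_smul, inner_sub_left, inner_sub_right, real_inner_smul_left,
      real_inner_smul_right, hx, h2] at h1
    linarith
  set a := inner ℝ (T x) (T x)
  set b := inner ℝ (T (T x)) (T x)
  have h1 := hq (a / (b + 1))
  have h2 : a / (b + 1) * b ≤ a := by
    rw [div_mul_eq_mul_div, div_le_iff₀ (by positivity)]
    nlinarith
  have h3 : 0 < a / (b + 1) := by positivity
  nlinarith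

theorem contDiff_gradX {f : X × P → ℝ} (hf : ContDiff ℝ 2 f) :
    ContDiff ℝ 1 fun z : X × P => gradX f z.1 z.2 := by
  have h1 : ContDiff ℝ 1 fun z : X × P =>
      (fderiv ℝ f z).comp (ContinuousLinearMap.inl ℝ X P) :=
    (hf.fderiv_right (by norm_num)).clm_comp contDiff_const
  have h2 : (fun z : X × P => gradX f z.1 z.2) = fun z =>
      (InnerProductSpace.toDual ℝ X).symm
        ((fderiv ℝ f z).comp (ContinuousLinearMap.inl ℝ X P)) := by
    funext z
    have hd : HasFDerivAt (fun x' => f (x', z.2))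
        ((fderiv ℝ f z).comp (ContinuousLinearMap.inl ℝ X P)) z.1 :=
      ((hf.differentiable (by norm_num)) (z.1, z.2)).hasFDerivAt.comp z.1
        (hasFDerivAt_prodMk_left z.1 z.2)
    rw [gradX, gradient, hd.fderiv]
  rw [h2]
  exact (InnerProductSpace.toDual ℝ X).symm.contDiff.comp h1

theorem contDiff_gradX_left {f : X × P → ℝ} (hf : ContDiff ℝ 2 f) (p : P) :
    ContDiff ℝ 1 fun x => gradX f x p :=
  (contDiff_gradX hf).comp (contDiff_id.prodMk contDiff_const)

theorem inner_hessX {f : X × P → ℝ} (hf : ContDiff ℝ 2 f) (x v w : X) (p : P) :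
    inner ℝ (hessX f x p v) w = fderiv ℝ (fderiv ℝ fun x' => f (x', p)) x v w := by
  have hdiff : DifferentiableAt ℝ (fun x' => gradX f x' p) x :=
    (contDiff_gradX_left hf p).differentiable (by norm_num) x
  have h : fderiv ℝ (fun x' => f (x', p)) = fun x' =>
      ((InnerProductSpace.toDual ℝ X).toContinuousLinearEquiv.toContinuousLinearMap)
        (gradX f x' p) := by
    funext x'
    ext w
    simp [← inner_gradX]
  have hcomp := ((InnerProductSpace.toDual ℝ X).toContinuousLinearEquiv
    |>.toContinuousLinearMap).hasFDerivAt.comp x hdiff.hasFDerivAt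
  rw [h]
  exact (DFunLike.congr_fun (DFunLike.congr_fun hcomp.fderiv v) w).symm

theorem hessX_isPositive {f : X × P → ℝ} (hf : ContDiff ℝ 2 f) {p : P}
    (hconv : ConvexOn ℝ univ fun x => f (x, p)) (x : X) : (hessX f x p).IsPositive := by
  have hfp : ContDiff ℝ 2 fun x' => f (x', p) := hf.comp (contDiff_id.prodMk contDiff_const)
  rw [ContinuousLinearMap.isPositive_iff]
  constructor
  · intro v w
    change inner ℝ (hessX f x p v) w = inner ℝ v (hessX f x p w)
    rw [real_inner_comm, real_inner_comm, inner_hessX hf, real_inner_comm, inner_hessX hf]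
    exact hfp.contDiffAt.isSymmSndFDerivAt (by simp) v w
  · intro v
    -- the restriction to the line through `x` in direction `v` has a monotone derivative
    have hline (s : ℝ) : HasDerivAt (fun s : ℝ => x + s • v) v s := by
      simpa using ((hasDerivAt_id s).smul_const v).const_add x
    have hd (s : ℝ) : HasDerivAt (fun s : ℝ => f (x + s • v, p))
        (inner ℝ (gradX f (x + s • v) p) v) s := by
      rw [inner_gradX]
      exact (hfp.differentiable (by norm_num) _).hasFDerivAt.comp_hasDerivAt s (hline s)
    have hconvline : ConvexOn ℝ univ (fun s : ℝ => f (x + s • v, p)) := by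
      have := hconv.comp_affineMap (AffineMap.lineMap x (x + v) : ℝ →ᵃ[ℝ] X)
      simpa [Function.comp_def, AffineMap.lineMap_apply, add_comm] using this
    have hmono : Monotone fun s : ℝ => inner ℝ (gradX f (x + s • v) p) v := by
      have h1 := hconvline.monotoneOn_deriv fun s _ => (hd s).differentiableAt
      rw [funext fun s => (hd s).deriv] at h1
      exact monotoneOn_univ.1 h1
    have hdd : HasDerivAt (fun s : ℝ => inner ℝ (gradX f (x + s • v) p) v)
        (inner ℝ (hessX f x p v) v) 0 := by
      have hg : HasFDerivAt (fun x' => gradX f x' p) (hessX f x p) (x + (0 : ℝ) • v) := by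
        rw [zero_smul, add_zero]
        exact ((contDiff_gradX_left hf p).differentiable (by norm_num) x).hasFDerivAt
      simpa using (hg.comp_hasDerivAt 0 (hline 0)).inner ℝ (hasDerivAt_const 0 v)
    rw [← hdd.deriv]
    exact hmono.deriv_nonneg

end Hessian


/-! ### Directional consequences of quadratic growth -/

section Growth

variable {E : Type*} [NormedAddCommGroup E] [InnerProductSpace ℝ E]

/-- Along a sequence in the graph of `∂φ` with limit direction `(a, b)`, quadratic growth bounds
the squared distance of the base points to `(∂φ)⁻¹(v₀)` by a multiple of `t² ⟨b, a⟩ + o(t²)`.  Hence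
`⟨b, a⟩ ≤ 0` forces equality and tangency of `a`. -/
theorem QuadraticGrowth.inner_eq_zero_and_mem_tangentCone {φ : E → EReal} (hφ : ∀ x, φ x ≠ ⊥)
    {x₀ v₀ : E} (h : QuadraticGrowth φ x₀ v₀) {t : ℕ → ℝ} {u w : ℕ → E} {a b : E}
    (ht : ∀ k, 0 < t k) (ht0 : Tendsto t atTop (𝓝 0)) (hu : Tendsto u atTop (𝓝 a))
    (hw : Tendsto w atTop (𝓝 b)) (hmem : ∀ k, v₀ + t k • w k ∈ subdiff φ (x₀ + t k • u k))
    (hab : inner ℝ b a ≤ 0) :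
    inner ℝ b a = 0 ∧ a ∈ tangentCone {x | v₀ ∈ subdiff φ x} x₀ := by
  obtain ⟨c, hc, ε, hε, hgrow⟩ := h.exists_mul_infDist_sq_le_inner hφ
  set D : ℕ → ℝ := fun k => Metric.infDist (x₀ + t k • u k) {x | v₀ ∈ subdiff φ x} / t k with hD
  have hx : Tendsto (fun k => x₀ + t k • u k) atTop (𝓝 x₀) := by
    simpa using (ht0.smul hu).const_add x₀
  have hbound : ∀ᶠ k in atTop, c * D k ^ 2 ≤ inner ℝ (w k) (u k) := by
    filter_upwards [hx.eventually (Metric.ball_mem_nhds x₀ hε)] with k hk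
    have h1 := hgrow _ hk _ (hmem k)
    rw [add_sub_cancel_left, add_sub_cancel_left, real_inner_smul_left, real_inner_smul_right] at h1
    have h2 : 0 < t k ^ 2 := pow_pos (ht k) 2
    rw [hD, div_pow, mul_div_assoc', div_le_iff₀ h2]
    linarith
  have hinner : Tendsto (fun k => inner ℝ (w k) (u k)) atTop (𝓝 (inner ℝ b a)) := hw.inner hu
  have hzero : inner ℝ b a = 0 :=
    le_antisymm hab (ge_of_tendsto hinner (hbound.mono fun k hk => le_trans (by positivity) hk))
  refine ⟨hzero, mem_tangentCone_of_tendsto_infDist ⟨x₀, h.1⟩ ht ht0 hu ?_⟩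
  rw [hzero] at hinner
  have hsq : Tendsto (fun k => D k ^ 2) atTop (𝓝 0) := by
    have h1 : Tendsto (fun k => c⁻¹ * inner ℝ (w k) (u k)) atTop (𝓝 0) := by
      simpa using hinner.const_mul c⁻¹
    refine squeeze_zero' (Eventually.of_forall fun k => by positivity) ?_ h1
    filter_upwards [hbound] with k hk
    rwa [inv_mul_eq_div, le_div_iff₀ hc, mul_comm]
  have hD0 (k : ℕ) : 0 ≤ D k := div_nonneg Metric.infDist_nonneg (ht k).le
  simpa [Real.sqrt_sq (hD0 _)] using hsq.sqrt

end Growth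

/-! ### The primal-dual systems -/

section System

variable {X Y P : Type*}
  [NormedAddCommGroup X] [InnerProductSpace ℝ X] [FiniteDimensional ℝ X]
  [NormedAddCommGroup Y] [InnerProductSpace ℝ Y] [FiniteDimensional ℝ Y]
  {f : X × P → ℝ} {g : Y → EReal} {K : X →ₗ[ℝ] Y} {x₀ : X} {y₀ : Y} {p₀ : P}

theorem add_mem_linPrimalDualSol_iff (h₀ : 0 = gradX f x₀ p₀ + LinearMap.adjoint K y₀)
    {ξ : X} {η : Y} {u : X} {v : Y} :
    (x₀, y₀) + (ξ, η) ∈ linPrimalDualSol f g K x₀ p₀ ((0, 0) + (u, v)) ↔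
      u = hessX f x₀ p₀ ξ + LinearMap.adjoint K η ∧
        K x₀ + (v + K ξ) ∈ subdiff (conj g) (y₀ + η) := by
  have h1 : gradX f x₀ p₀ + hessX f x₀ p₀ ξ + (LinearMap.adjoint K y₀ + LinearMap.adjoint K η) =
      hessX f x₀ p₀ ξ + LinearMap.adjoint K η := by
    rw [add_add_add_comm, ← h₀, zero_add]
  simp only [linPrimalDualSol, Prod.mk_add_mk, zero_add, mem_ofPred_eq, add_sub_cancel_left,
    map_add, h1]
  refine and_congr_right fun _ => ⟨?_, fun h => ⟨_, h, by abel⟩⟩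
  rintro ⟨w, hw, rfl⟩
  convert hw using 1
  abel

theorem mem_subdiff_conj_of_mem_primalDualSol
    (hsol : (x₀, y₀) ∈ primalDualSol f g K (p₀, 0)) : K x₀ ∈ subdiff (conj g) y₀ := by
  obtain ⟨-, w, hw, hw'⟩ := hsol
  rwa [eq_of_neg_add_eq_zero hw'.symm]

theorem srcq_of_isolatedCalm (hg : ProperLscConvex g)
    (hsol : (x₀, y₀) ∈ primalDualSol f g K (p₀, 0))
    (h : IsolatedCalm (linPrimalDualSol f g K x₀ p₀) (0, 0) (x₀, y₀)) : SRCQ g K x₀ y₀ := by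
  have hy₀ : y₀ ∈ subdiff g (K x₀) :=
    mem_subdiff_of_mem_subdiff_conj hg (mem_subdiff_conj_of_mem_primalDualSol hsol)
  refine Subset.antisymm ?_ (singleton_subset_iff.2 ⟨map_zero _, zero_mem_tangentCone hy₀⟩)
  rintro η ⟨hη : LinearMap.adjoint K η = 0, t, w, ht, ht0, hw, hmem⟩
  have he : Tendsto (fun k => (LinearMap.adjoint K (w k), (0 : Y))) atTop (𝓝 0) := by
    have h1 := ((LinearMap.adjoint K).continuous_of_finiteDimensional.tendsto η).comp hw
    rw [hη] at h1
    exact h1.prodMk_nhds tendsto_const_nhds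
  refine congrArg Prod.snd (h.direction_eq_zero ht ht0 he
    ((tendsto_const_nhds (x := (0 : X))).prodMk_nhds hw) fun k => ?_)
  rw [Prod.smul_mk, Prod.smul_mk]
  refine (add_mem_linPrimalDualSol_iff hsol.1).2 ⟨by simp, ?_⟩
  simpa using mem_subdiff_conj_of_mem_subdiff hg.ne_bot (hmem k)

theorem hessianKernelCondition_of_isolatedCalm
    (hsol : (x₀, y₀) ∈ primalDualSol f g K (p₀, 0))
    (h : IsolatedCalm (linPrimalDualSol f g K x₀ p₀) (0, 0) (x₀, y₀)) :
    HessianKernelCondition f g K x₀ p₀ y₀ := by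
  refine Subset.antisymm ?_ (singleton_subset_iff.2 ⟨map_zero _, ?_⟩)
  · rintro ξ ⟨hξ : hessX f x₀ p₀ ξ = 0, t, w, ht, ht0, hw, hmem⟩
    have he : Tendsto (fun k => ((0 : X), w k - K ξ)) atTop (𝓝 0) :=
      (tendsto_const_nhds (x := (0 : X))).prodMk_nhds (by simpa using hw.sub_const (K ξ))
    refine congrArg Prod.fst (h.direction_eq_zero ht ht0 he
      (tendsto_const_nhds (x := (ξ, (0 : Y)))) fun k => ?_)
    rw [Prod.smul_mk, Prod.smul_mk]
    refine (add_mem_linPrimalDualSol_iff hsol.1).2 ⟨by simp [hξ], ?_⟩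
    simpa [smul_sub] using hmem k
  · rw [mem_preimage, map_zero]
    exact zero_mem_tangentCone (mem_subdiff_conj_of_mem_primalDualSol hsol)

/-- A limit direction `(ξ, η)` satisfies `∇²ₓₓ f ξ + K* η = 0`, so `⟨η, K ξ⟩ = -⟨∇²ₓₓ f ξ, ξ⟩ ≤ 0`.
Quadratic growth of `g` and of `g*` turns this into equality and makes `K ξ` and `η` tangent to
`∂g*(y₀)` and `∂g(K x₀)`; the equality also gives `∇²ₓₓ f ξ = 0`, hence `K* η = 0`. -/
theorem isolatedCalm_linPrimalDualSol (hH : (hessX f x₀ p₀).IsPositive) (hg : ProperLscConvex g)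
    (hsol : (x₀, y₀) ∈ primalDualSol f g K (p₀, 0))
    (hgrow : PrimalDualQuadraticGrowth g (K x₀) y₀) (hsrcq : SRCQ g K x₀ y₀)
    (hker : HessianKernelCondition f g K x₀ p₀ y₀) :
    IsolatedCalm (linPrimalDualSol f g K x₀ p₀) (0, 0) (x₀, y₀) := by
  have hmem₀ : (x₀, y₀) ∈ linPrimalDualSol f g K x₀ p₀ (0, 0) := by
    have := (add_mem_linPrimalDualSol_iff (g := g) hsol.1 (ξ := 0) (η := 0) (u := 0) (v := 0)).2
      ⟨by simp, by simpa using mem_subdiff_conj_of_mem_primalDualSol hsol⟩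
    simpa using this
  refine isolatedCalm_of_forall_direction_eq_zero hmem₀ ?_
  rintro t e d ⟨ξ, η⟩ ht ht0 he hd hmem
  have hmem' (k : ℕ) : (e k).1 = hessX f x₀ p₀ (d k).1 + LinearMap.adjoint K (d k).2 ∧
      K x₀ + t k • ((e k).2 + K (d k).1) ∈ subdiff (conj g) (y₀ + t k • (d k).2) := by
    have h1 := (add_mem_linPrimalDualSol_iff (g := g) hsol.1 (ξ := t k • (d k).1)
      (η := t k • (d k).2) (u := t k • (e k).1) (v := t k • (e k).2)).1 (hmem k)
    simp only [map_smul, ← smul_add] at h1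
    exact ⟨smul_right_injective X (ht k).ne' h1.1, h1.2⟩
  have he1 : Tendsto (fun k => (e k).1) atTop (𝓝 0) := (continuous_fst.tendsto _).comp he
  have he2 : Tendsto (fun k => (e k).2) atTop (𝓝 0) := (continuous_snd.tendsto _).comp he
  have hd1 : Tendsto (fun k => (d k).1) atTop (𝓝 ξ) := (continuous_fst.tendsto _).comp hd
  have hd2 : Tendsto (fun k => (d k).2) atTop (𝓝 η) := (continuous_snd.tendsto _).comp hd
  have hlin : hessX f x₀ p₀ ξ + LinearMap.adjoint K η = 0 := by
    refine tendsto_nhds_unique ?_ he1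
    simp only [(hmem' _).1]
    exact (((hessX f x₀ p₀).continuous.tendsto ξ).comp hd1).add
      (((LinearMap.adjoint K).continuous_of_finiteDimensional.tendsto η).comp hd2)
  have hKξ : Tendsto (fun k => (e k).2 + K (d k).1) atTop (𝓝 (K ξ)) := by
    simpa using he2.add ((K.continuous_of_finiteDimensional.tendsto ξ).comp hd1)
  have hinner : inner ℝ η (K ξ) = -inner ℝ (hessX f x₀ p₀ ξ) ξ := by
    rw [← LinearMap.adjoint_inner_left, ← inner_neg_left, eq_neg_of_add_eq_zero_right hlin]
  have hnonpos : inner ℝ η (K ξ) ≤ 0 := by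
    rw [hinner]
    exact neg_nonpos.2 (hH.inner_nonneg_left ξ)
  obtain ⟨hzero, htanK⟩ := hgrow.1.inner_eq_zero_and_mem_tangentCone hg.ne_bot ht ht0 hKξ hd2
    (fun k => mem_subdiff_of_mem_subdiff_conj hg (hmem' k).2) hnonpos
  obtain ⟨-, htan⟩ := hgrow.2.inner_eq_zero_and_mem_tangentCone (conj_ne_bot hg.exists_ne_top)
    ht ht0 hd2 hKξ (fun k => (hmem' k).2) (by rwa [real_inner_comm])
  have hset : {x | y₀ ∈ subdiff g x} = subdiff (conj g) y₀ := ext fun _ =>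
    ⟨mem_subdiff_conj_of_mem_subdiff hg.ne_bot, mem_subdiff_of_mem_subdiff_conj hg⟩
  have hset' : {y | K x₀ ∈ subdiff (conj g) y} = subdiff g (K x₀) := ext fun _ =>
    ⟨mem_subdiff_of_mem_subdiff_conj hg, mem_subdiff_conj_of_mem_subdiff hg.ne_bot⟩
  rw [hset] at htanK
  rw [hset'] at htan
  have hHξ : hessX f x₀ p₀ ξ = 0 :=
    eq_zero_of_isPositive_of_inner_eq_zero hH (by linarith)
  have hKη : LinearMap.adjoint K η = 0 := by rwa [hHξ, zero_add] at hlin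
  have hξ : ξ ∈ ({0} : Set X) := hker ▸ ⟨hHξ, htanK⟩
  have hη : η ∈ ({0} : Set Y) := hsrcq ▸ ⟨hKη, htan⟩
  exact Prod.ext hξ hη

/-- A solution `(x, y)` of the nonlinear system for `(p, v)` solves the linearized one for `(u, v)`
with `u = ∇ₓ f(x₀, p₀) + ∇²ₓₓ f(x₀, p₀) (x - x₀) - ∇ₓ f(x, p)`.  By differentiability of `∇ₓ f`,
`‖u‖ ≤ O(‖p - p₀‖) + (2ℓ)⁻¹ ‖x - x₀‖`, and the last term is absorbed by the left-hand side of the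
calmness estimate. -/
theorem isolatedCalm_primalDualSol [NormedAddCommGroup P] [InnerProductSpace ℝ P]
    (hf : ContDiff ℝ 2 f) (hsol : (x₀, y₀) ∈ primalDualSol f g K (p₀, 0))
    (h : IsolatedCalm (linPrimalDualSol f g K x₀ p₀) (0, 0) (x₀, y₀)) :
    IsolatedCalm (primalDualSol f g K) (p₀, 0) (x₀, y₀) := by
  obtain ⟨-, ℓ, hℓ, U, hU, V, hV, hcalm⟩ := h
  set G : X × P → X := fun z => gradX f z.1 z.2 with hG
  have hGd : HasFDerivAt G (fderiv ℝ G (x₀, p₀)) (x₀, p₀) :=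
    ((contDiff_gradX hf).differentiable (by norm_num) _).hasFDerivAt
  set G' := fderiv ℝ G (x₀, p₀)
  have hHess (ξ : X) : hessX f x₀ p₀ ξ = G' (ξ, 0) := by
    have h1 : HasFDerivAt (fun x => gradX f x p₀) (G'.comp (ContinuousLinearMap.inl ℝ X P)) x₀ :=
      HasFDerivAt.comp (g := G) (f := fun x => (x, p₀)) x₀ hGd
        (hasFDerivAt_prodMk_left x₀ p₀)
    rw [hessX, h1.fderiv]
    rfl
  set R : X × P → X := fun z => gradX f x₀ p₀ + hessX f x₀ p₀ (z.1 - x₀) - G z with hR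
  have hRcont : Continuous R :=
    (continuous_const.add
      ((hessX f x₀ p₀).continuous.comp (continuous_fst.sub continuous_const))).sub
      (contDiff_gradX hf).continuous
  have hRbound : ∀ᶠ z in 𝓝 (x₀, p₀),
      ‖R z‖ ≤ ‖G'‖ * dist z.2 p₀ + (2 * ℓ)⁻¹ * (dist z.1 x₀ + dist z.2 p₀) := by
    filter_upwards [hGd.isLittleO.def (inv_pos.2 (by positivity : 0 < 2 * ℓ))] with z hz
    have h1 : R z = -(G z - G (x₀, p₀) - G' (z - (x₀, p₀))) - G' (0, z.2 - p₀) := by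
      have h2 : z - (x₀, p₀) = (z.1 - x₀, 0) + (0, z.2 - p₀) := by ext <;> simp
      rw [h2, map_add, ← hHess, hR, hG]
      simp only
      abel
    have h3 : ‖G' (0, z.2 - p₀)‖ ≤ ‖G'‖ * dist z.2 p₀ := by
      refine (G'.le_opNorm _).trans_eq ?_
      rw [Prod.norm_mk, norm_zero, max_eq_right (norm_nonneg _), dist_eq_norm]
    have h4 : ‖z - (x₀, p₀)‖ ≤ dist z.1 x₀ + dist z.2 p₀ := by
      rw [dist_eq_norm, dist_eq_norm]
      exact max_le (le_add_of_nonneg_right (norm_nonneg _)) (le_add_of_nonneg_left (norm_nonneg _))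
    rw [h1]
    refine (norm_sub_le _ _).trans ?_
    rw [norm_neg, add_comm]
    exact add_le_add h3 (hz.trans (mul_le_mul_of_nonneg_left h4 (by positivity)))
  -- all smallness requirements on `(x, y)` and `(p, v)` at once
  have hev : ∀ᶠ w in 𝓝 (x₀, y₀) ×ˢ 𝓝 (p₀, (0 : Y)), w.1 ∈ U ∧
      (R (w.1.1, w.2.1), w.2.2) ∈ V ∧ ‖R (w.1.1, w.2.1)‖ ≤
        ‖G'‖ * dist w.2.1 p₀ + (2 * ℓ)⁻¹ * (dist w.1.1 x₀ + dist w.2.1 p₀) := by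
    rw [← nhds_prod_eq]
    have hc : Continuous fun w : (X × Y) × (P × Y) => (w.1.1, w.2.1) := by fun_prop
    have hc' : Continuous fun w : (X × Y) × (P × Y) => (R (w.1.1, w.2.1), w.2.2) :=
      (hRcont.comp hc).prodMk (by fun_prop)
    have hR₀ : R (x₀, p₀) = 0 := by simp [hR, hG]
    refine (continuous_fst.continuousAt.eventually_mem hU).and
      ((hc'.continuousAt.eventually_mem ?_).and
        ((hc.tendsto ((x₀, y₀), (p₀, (0 : Y)))).eventually hRbound))
    simpa only [hR₀] using hV
  obtain ⟨U', hU', V', hV', hUV⟩ := mem_prod_iff.1 hev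
  refine ⟨hsol, 2 * ℓ * (‖G'‖ + (2 * ℓ)⁻¹ + 1), by positivity, U', hU', V', hV', ?_⟩
  rintro ⟨p, v⟩ hq ⟨x, y⟩ ⟨⟨hgrad, hsub⟩, hz⟩
  obtain ⟨hzU, hqV, hle⟩ := hUV (mk_mem_prod hz hq)
  have hlinmem : (x, y) ∈ linPrimalDualSol f g K x₀ p₀ (R (x, p), v) := by
    refine ⟨?_, hsub⟩
    have h1 : LinearMap.adjoint K y = -G (x, p) := (neg_eq_of_add_eq_zero_right hgrad.symm).symm
    simp only [hR, h1]
    abel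
  have h1 := hcalm _ hqV _ ⟨hlinmem, hzU⟩
  have hx : dist x x₀ ≤ dist (x, y) (x₀, y₀) := le_max_left _ _
  have hp : dist p p₀ ≤ dist (p, v) (p₀, (0 : Y)) := le_max_left _ _
  have hv : dist v 0 ≤ dist (p, v) (p₀, (0 : Y)) := le_max_right _ _
  have h2 : dist (R (x, p), v) ((0 : X), (0 : Y)) ≤ ‖R (x, p)‖ + dist v 0 := by
    rw [← dist_zero_right (R (x, p))]
    exact max_le (le_add_of_nonneg_right dist_nonneg) (le_add_of_nonneg_left dist_nonneg)
  set D := dist (x, y) (x₀, y₀)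
  set q := dist (p, v) (p₀, (0 : Y))
  have h3 : dist (R (x, p), v) ((0 : X), (0 : Y)) ≤
      ‖G'‖ * q + (2 * ℓ)⁻¹ * (D + q) + q := by
    refine h2.trans (add_le_add (hle.trans ?_) hv)
    dsimp only
    gcongr
  have h4 : D ≤ ℓ * (‖G'‖ * q + (2 * ℓ)⁻¹ * (D + q) + q) :=
    h1.trans (mul_le_mul_of_nonneg_left h3 hℓ.le)
  have h5 : ℓ * (2 * ℓ)⁻¹ = 1 / 2 := by field_simp
  linear_combination 2 * h4 + 2 * D * h5

end System

end PrimalDual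
end

theorem theorem4p8 {X Y P : Type*}
    [NormedAddCommGroup X] [InnerProductSpace ℝ X] [FiniteDimensional ℝ X]
    [NormedAddCommGroup Y] [InnerProductSpace ℝ Y] [FiniteDimensional ℝ Y]
    [NormedAddCommGroup P] [InnerProductSpace ℝ P] [FiniteDimensional ℝ P]
    (f : X × P → ℝ) (hf : ContDiff ℝ 2 f)
    (hf_conv : ∀ p, ConvexOn ℝ Set.univ (fun x => f (x, p)))
    (g : Y → EReal) (hg : PrimalDual.ProperLscConvex g)
    (K : X →ₗ[ℝ] Y) (x₀ : X) (y₀ : Y) (p₀ : P)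
    (hsol : (x₀, y₀) ∈ PrimalDual.primalDualSol f g K (p₀, 0)) :
    (PrimalDual.IsolatedCalm (PrimalDual.linPrimalDualSol f g K x₀ p₀) (0, 0) (x₀, y₀) →
      PrimalDual.SRCQ g K x₀ y₀ ∧ PrimalDual.HessianKernelCondition f g K x₀ p₀ y₀) ∧
    (PrimalDual.PrimalDualQuadraticGrowth g (K x₀) y₀ →
      PrimalDual.SRCQ g K x₀ y₀ → PrimalDual.HessianKernelCondition f g K x₀ p₀ y₀ →
      PrimalDual.IsolatedCalm (PrimalDual.linPrimalDualSol f g K x₀ p₀) (0, 0) (x₀, y₀) ∧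
      PrimalDual.IsolatedCalm (PrimalDual.primalDualSol f g K) (p₀, 0) (x₀, y₀)) := by
  have hH := PrimalDual.hessX_isPositive hf (hf_conv p₀) x₀
  refine ⟨fun h => ⟨PrimalDual.srcq_of_isolatedCalm hg hsol h,
    PrimalDual.hessianKernelCondition_of_isolatedCalm hsol h⟩, fun hgrow hsrcq hker => ?_⟩
  have h := PrimalDual.isolatedCalm_linPrimalDualSol hH hg hsol hgrow hsrcq hker
  exact ⟨h, PrimalDual.isolatedCalm_primalDualSol hf hsol h⟩
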